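/- Let $\mathbb K=\mathbb R$ or $\mathbb C$. For a locally convex Hausdorff space $E$ over $\mathbb K$ let $E'$ be its topological dual, let $E_b'$ be $E'$ with the topology of uniform convergence on the bounded subsets of $E$, and let $\tau_{c}(E',E)$ be the topology on $E'$ of uniform convergence on the compact subsets of $E$. A topological isomorphism is a linear homeomorphism. Let $(X,\tau)$ be a locally convex Hausdorff space over $\mathbb K$ with a complete barrelled predual $(Y,\varphi)$, i.e. $Y$ is a complete barrelled locally convex Hausdorff space over $\mathbb K$ and $\varphi\colon (X,\tau)\to Y_b'$ is a topological isomorphism. Let $\mathcal B$ be the family of $\tau$-bounded subsets of $X$. Let $\sigma_\varphi(X,Y)$ and $\tau_{c,\varphi}(X,Y)$ be the topologies on $X$ given by the seminorms $x\mapsto \sup_{y\in N}|\varphi(x)(y)|$, where $N$ ranges over the finite, respectively the compact, subsets of $Y$. Let $\widetilde\gamma_\varphi$ be the finest locally convex Hausdorff topology on $X$ which coincides with $\sigma_\varphi(X,Y)$ on every $\tau$-bounded set. Let $X_{\mathcal B,\sigma_\varphi(X,Y)}'$ be the space of all linear functionals on $X$ whose restriction to every $B\in\mathcal B$ is $\sigma_\varphi(X,Y)$-continuous,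 equipped with the topology $\beta$ of uniform convergence on the members of $\mathcal B$. Let $\mathcal J_Y\colon Y\to (Y',\tau_c(Y',Y))_b'$, $y\mapsto[y'\mapsto y'(y)]$. Then the following assertions hold. (a) $\sigma_\varphi(X,Y)$ is a locally convex Hausdorff topology for which $(X,\tau)$ satisfies (BBC) and (CNC): every $\tau$-bounded subset of $X$ is contained in an absolutely convex, $\tau$-bounded, $\sigma_\varphi(X,Y)$-compact set, and $\tau$ has a $0$-neighbourhood basis of absolutely convex $\sigma_\varphi(X,Y)$-closed sets. Moreover $\widetilde\gamma_\varphi=\tau_{c,\varphi}(X,Y)$, and a subset of $X$ is $\tau$-bounded if and only if it is $\widetilde\gamma_\varphi$-bounded (this is condition $(\mathrm B\tau\mathrm B\widetilde\gamma_\varphi)$). (b) The three maps $$\kappa_\varphi\colon (Y',\tau_c(Y',Y))_b'\to (X,\widetilde\gamma_\varphi)_b',\quad y''\mapsto y''\circ\varphi,$$ $$\kappa_\varphi\circ\mathcal J_Y\colon Y\to (X,\widetilde\gamma_\varphi)_b',$$ $$\mathcal I_\varphi\colon (X,\tau)\to((X,\widetilde\gamma_\varphi)_b')_b',\quad x\mapsto[x'\mapsto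 x'(x)],$$ are well-defined topological isomorphisms. The dual map $(\kappa_\varphi\circ\mathcal J_Y)^t\colon ((X,\widetilde\gamma_\varphi)_b')'\to Y'$, $x''\mapsto x''\circ\kappa_\varphi\circ\mathcal J_Y$, satisfies $(\kappa_\varphi\circ\mathcal J_Y)^t=\varphi\circ\mathcal I_\varphi^{-1}$. Furthermore $(X,\widetilde\gamma_\varphi)_b'=(X_{\mathcal B,\sigma_\varphi(X,Y)}',\beta)$, with the same functionals and the same topology. (c) For every map $x'\colon X\to\mathbb K$ the following are equivalent: $x'\in(X,\widetilde\gamma_\varphi)'$; $x'\in(X,\sigma_\varphi(X,Y))'$; there is $y\in Y$ with $x'=\varphi(\cdot)(y)$. In this case $y$ is unique. -/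

import Mathlib

open Topology Bornology
open scoped ComplexOrder CompactConvergenceCLM

noncomputable section

/-! Over `𝕜 = ℝ` or `ℂ`, convexity and local convexity are taken with respect to the order
`0 ≤ a ↔ a is a nonnegative real` on `𝕜`, so they are the usual (real) notions. The order on
topologies is Mathlib's one: `t ≤ s` means that `t` is finer than `s`. -/

namespace LCDual

/-! ### A vector space with another topology -/

section Copy

variable {X : Type*} (t : TopologicalSpace X)

instance instAddCommGroupWithTopology [AddCommGroup X] : AddCommGroup (WithTopology X t) :=
  (WithTopology.equiv X t).addCommGroup

instance instModuleWithTopology (𝕜 : Type*) [Semiring 𝕜] [AddCommGroup X] [Module 𝕜 X] :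
    Module 𝕜 (WithTopology X t) :=
  (WithTopology.equiv X t).module 𝕜

end Copy

section General

variable (𝕜 : Type*) [RCLike 𝕜] {X : Type*} [AddCommGroup X] [Module 𝕜 X]

/-- `t` is a locally convex Hausdorff (vector space) topology on the `𝕜`-vector space `X`. -/
structure IsLCHausdorff (t : TopologicalSpace X) : Prop where
  isTopologicalAddGroup : @IsTopologicalAddGroup X t _
  continuousSMul : @ContinuousSMul 𝕜 X _ _ t
  locallyConvexSpace : @LocallyConvexSpace 𝕜 X _ _ _ _ t
  t2Space : @T2Space X t

/-- The subset `B` of `X` is bounded for the topology `t`. -/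
def IsBddFor (t : TopologicalSpace X) (B : Set X) : Prop :=
  @IsVonNBounded 𝕜 X _ _ _ t B

/-- Condition (BBC) of `(X, τ)` for the locally convex Hausdorff topology `τ'`. -/
def BBC (τ τ' : TopologicalSpace X) : Prop :=
  IsLCHausdorff 𝕜 τ' ∧ ∀ B : Set X, IsBddFor 𝕜 τ B →
    ∃ K : Set X, B ⊆ K ∧ AbsConvex 𝕜 K ∧ IsBddFor 𝕜 τ K ∧ @IsCompact X τ' K

/-- Condition (CNC) of `(X, τ)` for the locally convex Hausdorff topology `τ'`. -/
def CNC (τ τ' : TopologicalSpace X) : Prop :=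
  IsLCHausdorff 𝕜 τ' ∧ ∃ U₀ : Set (Set X),
    (∀ U ∈ U₀, AbsConvex 𝕜 U ∧ IsClosed[τ'] U) ∧
    (@nhds X τ 0).HasBasis (fun U : Set X => U ∈ U₀) id

/-- The topologies `t` and `τ'` coincide on every `τ`-bounded set. -/
def CoincideOnBdd (τ τ' t : TopologicalSpace X) : Prop :=
  ∀ B : Set X, IsBddFor 𝕜 τ B →
    t.induced (Subtype.val : B → X) = τ'.induced (Subtype.val : B → X)

/-- The generalised mixed topology of `τ` and `τ'`: the finest locally convex Hausdorff topology
which coincides with `τ'` on `τ`-bounded sets (see `isLeast_mixedTopology`). -/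
def mixedTopology (τ τ' : TopologicalSpace X) : TopologicalSpace X :=
  sInf {t | IsLCHausdorff 𝕜 t ∧ CoincideOnBdd 𝕜 τ τ' t}

theorem isLeast_mixedTopology (τ : TopologicalSpace X) {τ' : TopologicalSpace X}
    (h : IsLCHausdorff 𝕜 τ') :
    IsLeast {t | IsLCHausdorff 𝕜 t ∧ CoincideOnBdd 𝕜 τ τ' t} (mixedTopology 𝕜 τ τ') := by
  have hmem : τ' ∈ {t | IsLCHausdorff 𝕜 t ∧ CoincideOnBdd 𝕜 τ τ' t} :=
    ⟨h, fun _ _ => rfl⟩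
  refine ⟨⟨⟨?_, ?_, ?_, ?_⟩, ?_⟩, fun t ht => sInf_le ht⟩
  · exact topologicalAddGroup_sInf fun t ht => ht.1.isTopologicalAddGroup
  · exact continuousSMul_sInf fun t ht => ht.1.continuousSMul
  · exact LocallyConvexSpace.sInf fun t ht => ht.1.locallyConvexSpace
  · exact @T2Space.of_injective_continuous X X (mixedTopology 𝕜 τ τ') τ' h.t2Space id
      Function.injective_id (continuous_id_iff_le.2 (sInf_le hmem))
  · intro B hB
    refine le_antisymm (induced_mono (sInf_le hmem)) ?_
    rw [mixedTopology, sInf_eq_iInf, induced_iInf]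
    refine le_iInf fun t => ?_
    rw [induced_iInf]
    exact le_iInf fun ht => (ht.2 B hB).ge

/-- The `τ`-bounded sets and the `γ`-bounded sets are the same. -/
def SameBdd (τ γ : TopologicalSpace X) : Prop :=
  ∀ B : Set X, IsBddFor 𝕜 τ B ↔ IsBddFor 𝕜 γ B

/-- The space of all linear functionals on `X` whose restrictions to `τ`-bounded sets are
`τ'`-continuous. -/
def bddContDual (τ τ' : TopologicalSpace X) : Submodule 𝕜 (Module.Dual 𝕜 X) where
  carrier := {f | ∀ B : Set X, IsBddFor 𝕜 τ B → @ContinuousOn X 𝕜 τ' _ f B}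
  add_mem' hf hg B hB := by
    let := τ'
    exact (hf B hB).add (hg B hB)
  zero_mem' B _ := by
    let := τ'
    exact continuousOn_const
  smul_mem' c f hf B hB := by
    let := τ'
    exact (hf B hB).const_smul c

/-- The topology of uniform convergence on `τ`-bounded sets on `bddContDual 𝕜 τ τ'`. -/
instance instTopologicalSpaceBddContDual (τ τ' : TopologicalSpace X) :
    TopologicalSpace (bddContDual 𝕜 τ τ') :=
  (UniformOnFun.topologicalSpace X 𝕜 {B | IsBddFor 𝕜 τ B}).induced
    fun f => UniformOnFun.ofFun {B | IsBddFor 𝕜 τ B} (f : Module.Dual 𝕜 X)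

end General

section Predual

variable {𝕜 : Type*} [RCLike 𝕜] {X Y : Type*} [AddCommGroup Y] [Module 𝕜 Y] [TopologicalSpace Y]

/-- For `φ : X → Y'` and a family `𝔖` of subsets of `Y`: the topology on `X` of uniform
convergence of `y ↦ φ x y` on the members of `𝔖`. -/
def pairingTopology (φ : X → StrongDual 𝕜 Y) (𝔖 : Set (Set Y)) : TopologicalSpace X :=
  (UniformConvergenceCLM.instTopologicalSpace (RingHom.id 𝕜) 𝕜 𝔖).induced
    fun x => UniformConvergenceCLM.ofFun (RingHom.id 𝕜) 𝕜 𝔖 (φ x)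

/-- `σ_φ(X, Y)`, given by the seminorms `x ↦ sup_{y ∈ N} |φ x y|`, `N ⊆ Y` finite. -/
def sigmaTopology (φ : X → StrongDual 𝕜 Y) : TopologicalSpace X :=
  pairingTopology φ {N | N.Finite}

/-- `τ_{c,φ}(X, Y)`, given by the seminorms `x ↦ sup_{y ∈ N} |φ x y|`, `N ⊆ Y` compact. -/
def compactTopology (φ : X → StrongDual 𝕜 Y) : TopologicalSpace X :=
  pairingTopology φ {N | IsCompact N}

/-- The generalised mixed topology of `τ` and `σ_φ(X, Y)`. -/
def mixedTopologyOf [AddCommGroup X] [Module 𝕜 X] (τ : TopologicalSpace X)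
    (φ : X → StrongDual 𝕜 Y) : TopologicalSpace X :=
  mixedTopology 𝕜 τ (sigmaTopology φ)

variable (𝕜 Y) in
/-- The evaluation map `J_Y : Y → (Y', τ_c(Y', Y))'`, `y ↦ [y' ↦ y' y]`. -/
def evalCompact : Y → StrongDual 𝕜 (Y →L_c[𝕜] 𝕜) := fun y =>
  { toFun := fun y' => y' y
    map_add' := fun _ _ => rfl
    map_smul' := fun _ _ => rfl
    cont := continuous_eval_const y }

end Predual

end LCDual

end

open LCDual

noncomputable section

namespace LCDual

/-! ### Consequences of Hahn–Banach for seminorms. -/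

section Algebra

variable {𝕜 : Type*} [RCLike 𝕜] {E : Type*} [AddCommGroup E] [Module 𝕜 E]

/-! Everything rests on the polars `dualBall φ p` of continuous seminorms `p` on `Y`. As `Y` is
barrelled, Banach–Steinhaus puts every `σ_φ`-bounded set inside such a polar, and polars are
`τ`-bounded; so all topologies between `τ` and `σ_φ` have the same bounded sets, the subsets of
polars. Polars are `σ_φ`-compact (Alaoglu) and, being equicontinuous, inherit the same topology from
`σ_φ` and `τ_{c,φ}`. Hence the mixed topology is finer than `τ_{c,φ}`.

Conversely, let `t` be locally convex and agree with `σ_φ` on polars. By Grothendieck's theorem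
(`exists_eq_eval_of_continuousOn_dualBall`), where completeness of `Y` enters, `t`-continuous
functionals are evaluations at points of `Y`. For a `t`-continuous seminorm `q`, the set `N` of all
`y` with `|φ x y| ≤ q x` for every `x` is compact (`isCompact_setOf_norm_le_seminorm`), and `q x` is
the supremum of `|φ x y|` over `N` by Hahn–Banach. So `τ_{c,φ}` is finer than `t`.

Grothendieck's theorem also identifies the dual of `(X, τ_{c,φ})` with `Y`. The strong topology on
it is that of `Y`, because the bounded sets are the subsets of polars and `p` is a supremum over its
polar. The maps `κ` and `I` come from `φ` and this identification by transposition. -/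

theorem exists_dual_le_seminorm_eq (p : Seminorm 𝕜 E) (x : E) :
    ∃ f : Module.Dual 𝕜 E, (∀ z, ‖f z‖ ≤ p z) ∧ f x = (p x : 𝕜) := by
  rcases eq_or_ne x 0 with rfl | hx
  · exact ⟨0, fun z => by simp, by simp⟩
  let e := LinearEquiv.toSpanNonzeroSingleton 𝕜 E x hx
  obtain ⟨g, hg, hgp⟩ := Module.Dual.exists_extension_of_le_seminorm (𝕜 ∙ x)
    ((p x : 𝕜) • (e.symm : (𝕜 ∙ x) →ₗ[𝕜] 𝕜)) (p := p) (by
      intro z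
      obtain ⟨c, rfl⟩ := e.surjective z
      have : ((e c : 𝕜 ∙ x) : E) = c • x := rfl
      simp [this, map_smul_eq_mul, norm_smul, mul_comm, abs_of_nonneg (apply_nonneg p x)])
  refine ⟨g, hgp, ?_⟩
  have := hg (e 1)
  have h1 : ((e 1 : 𝕜 ∙ x) : E) = x := by
    simp [e]
  rw [h1] at this
  simpa [RCLike.real_smul_eq_coe_mul] using this

/-- Since `p x` may vanish, `x` is normalised by an arbitrary `t > p x`, and `t` then decreases to
`p x`. -/
theorem norm_le_mul_seminorm (f : Module.Dual 𝕜 E) (p : Seminorm 𝕜 E) {ε : ℝ}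
    (h : ∀ x, p x ≤ 1 → ‖f x‖ ≤ ε) (x : E) : ‖f x‖ ≤ ε * p x := by
  have hε : 0 ≤ ε := (norm_nonneg _).trans (h 0 (by simp))
  have key : ∀ t, p x < t → ‖f x‖ ≤ ε * t := by
    intro t ht
    have ht0 : 0 < t := (apply_nonneg p x).trans_lt ht
    have := h (((t⁻¹ : ℝ) : 𝕜) • x) (by
      rw [map_smul_eq_mul, RCLike.norm_ofReal, abs_of_pos (inv_pos.2 ht0), inv_mul_le_iff₀ ht0]
      linarith)
    rwa [map_smul, norm_smul, RCLike.norm_ofReal, abs_of_pos (inv_pos.2 ht0),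
      inv_mul_le_iff₀ ht0, mul_comm] at this
  rcases hε.eq_or_lt with rfl | hε
  · simpa using key _ (lt_add_one _)
  · rw [← div_le_iff₀' hε]
    exact le_of_forall_gt_imp_ge_of_dense fun t ht => (div_le_iff₀' hε).2 (key t ht)

/-- On the diagonal of `E × E` the functional `(x, x) ↦ f x` is dominated by `p ⊕ q`; a Hahn–Banach
extension, restricted to the two factors, gives `g` and `k`. -/
theorem exists_add_of_norm_le_add (f : Module.Dual 𝕜 E) (p q : Seminorm 𝕜 E)
    (h : ∀ x, ‖f x‖ ≤ p x + q x) :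
    ∃ g k : Module.Dual 𝕜 E, f = g + k ∧ (∀ x, ‖g x‖ ≤ p x) ∧ ∀ x, ‖k x‖ ≤ q x := by
  let D : Submodule 𝕜 (E × E) := LinearMap.range (LinearMap.prod (LinearMap.id (R := 𝕜) (M := E))
    LinearMap.id)
  let R : Seminorm 𝕜 (E × E) := p.comp (LinearMap.fst 𝕜 E E) + q.comp (LinearMap.snd 𝕜 E E)
  obtain ⟨G, hG, hGR⟩ := Module.Dual.exists_extension_of_le_seminorm D
    ((f.comp (LinearMap.fst 𝕜 E E)).comp D.subtype) (p := R) (by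
      rintro ⟨_, x, rfl⟩
      simpa [R] using h x)
  refine ⟨G.comp (LinearMap.inl 𝕜 E E), G.comp (LinearMap.inr 𝕜 E E), ?_, fun x => ?_, fun x => ?_⟩
  · ext x
    have := hG ⟨(x, x), x, rfl⟩
    simp only [LinearMap.coe_comp, Function.comp_apply, Submodule.subtype_apply,
      LinearMap.fst_apply] at this
    rw [← this]
    simp [← map_add]
  · simpa [R] using hGR (x, 0)
  · simpa [R] using hGR (0, x)

theorem mem_span_of_norm_le_sum {ι : Type*} [Fintype ι] (k : Module.Dual 𝕜 E)
    (L : ι → Module.Dual 𝕜 E) {C : ℝ} (h : ∀ x, ‖k x‖ ≤ C * ∑ i, ‖L i x‖) :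
    k ∈ Submodule.span 𝕜 (Set.range L) := by
  refine mem_span_of_iInf_ker_le_ker fun x hx => ?_
  have : ∀ i, L i x = 0 := by simpa using hx
  simpa [this] using h x

end Algebra

/-! ### Approximation by evaluations on a polar. -/

section DualBall

variable {𝕜 : Type*} [RCLike 𝕜] {X Y : Type*} [AddCommGroup X] [Module 𝕜 X]
  [AddCommGroup Y] [Module 𝕜 Y] [TopologicalSpace Y]

/-- The polar of the unit ball of the seminorm `p`. -/
def dualBall (φ : X → StrongDual 𝕜 Y) (p : Seminorm 𝕜 Y) : Set X :=
  {x | ∀ y, ‖φ x y‖ ≤ p y}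

/-- Approximation on a polar of a functional that is small on a weak neighbourhood of `0` in it. -/
theorem exists_norm_sub_le_on_dualBall (φ : X →ₗ[𝕜] StrongDual 𝕜 Y) (p : Seminorm 𝕜 Y)
    (f : Module.Dual 𝕜 X) {ε δ : ℝ} (hδ : 0 < δ) (F : Finset Y)
    (h : ∀ x ∈ dualBall φ p, (∀ y ∈ F, ‖φ x y‖ ≤ δ) → ‖f x‖ ≤ ε) :
    ∃ y, ∀ x ∈ dualBall φ p, ‖f x - φ x y‖ ≤ ε := by
  -- `S` is the span of the polar, the largest subspace on which the gauge of the polar is finite.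
  let S : Submodule 𝕜 X :=
    { carrier := {x | BddAbove (Set.range fun y : {y // p y ≤ 1} => ‖φ x y‖)}
      add_mem' := by
        rintro a b ⟨A, hA⟩ ⟨B, hB⟩
        refine ⟨A + B, ?_⟩
        rintro _ ⟨y, rfl⟩
        simpa using (norm_add_le _ _).trans (add_le_add (hA ⟨y, rfl⟩) (hB ⟨y, rfl⟩))
      zero_mem' := ⟨0, by rintro _ ⟨y, rfl⟩; simp⟩
      smul_mem' := by
        rintro c a ⟨A, hA⟩
        refine ⟨‖c‖ * A, ?_⟩
        rintro _ ⟨y, rfl⟩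
        simpa using mul_le_mul_of_nonneg_left (hA ⟨y, rfl⟩) (norm_nonneg c) }
  let ev : Y → Module.Dual 𝕜 S := fun y =>
    { toFun := fun x => φ x y
      map_add' := fun _ _ => by simp
      map_smul' := fun _ _ => by simp }
  let P₁ : {y // p y ≤ 1} → Seminorm 𝕜 S := fun y => (normSeminorm 𝕜 𝕜).comp (ev y)
  have hP₁ : BddAbove (Set.range P₁) := Seminorm.bddAbove_range_iff.2 fun x => x.2
  have hP : ∀ x : S, (⨆ y, P₁ y) x ≤ 1 ↔ (x : X) ∈ dualBall φ p := by
    intro x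
    have : Nonempty {y // p y ≤ 1} := ⟨⟨0, by simp⟩⟩
    have hx' : BddAbove (Set.range fun y => P₁ y x) := x.2
    rw [Seminorm.iSup_apply hP₁, ciSup_le_iff hx']
    constructor
    · intro hx y
      simpa using norm_le_mul_seminorm (φ x : Module.Dual 𝕜 Y) p (fun y hy => hx ⟨y, hy⟩) y
    · exact fun hx y => (hx y).trans y.2
  let Q : Seminorm 𝕜 S := ∑ y ∈ F, (normSeminorm 𝕜 𝕜).comp (ev y)
  have hQ : ∀ x : S, Q x = ∑ y ∈ F, ‖φ x y‖ := fun x => by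
    simp [Q, ev]
  have hε : 0 ≤ ε := (norm_nonneg _).trans (h 0 (fun y => by simp) (by simp [hδ.le]))
  let ε' : NNReal := ⟨ε, hε⟩
  let δ' : NNReal := ⟨δ⁻¹, (inv_pos.2 hδ).le⟩
  -- With `P` the gauge of the polar, `P + δ⁻¹ Q ≤ 1` forces membership in the polar and `‖φ x y‖ ≤
  -- δ` on `F`.
  have hf := norm_le_mul_seminorm (ε := ε) (f.comp S.subtype) ((⨆ y, P₁ y) + δ' • Q) (by
    intro x hx
    have h1 : (⨆ y, P₁ y) x + δ⁻¹ * Q x ≤ 1 := hx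
    have hQ0 : 0 ≤ δ⁻¹ * Q x := mul_nonneg (inv_pos.2 hδ).le (apply_nonneg Q x)
    have hP0 : 0 ≤ (⨆ y, P₁ y) x := apply_nonneg _ x
    refine h x ((hP x).1 (by linarith)) fun y hy => ?_
    have h2 : δ⁻¹ * Q x ≤ 1 := by linarith
    rw [inv_mul_le_iff₀ hδ, mul_one, hQ] at h2
    exact (Finset.single_le_sum (f := fun y => ‖φ x y‖) (fun _ _ => norm_nonneg _) hy).trans h2)
  obtain ⟨g, k, hgk, hg, hk⟩ := exists_add_of_norm_le_add (f.comp S.subtype)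
    (ε' • (⨆ y, P₁ y)) (ε' • (δ' • Q)) (by
      intro x
      refine (hf x).trans (le_of_eq ?_)
      exact mul_add _ _ _)
  -- The part dominated by `Q` vanishes wherever all evaluations at points of `F` do, so it is a
  -- combination of them: evaluation at one point of `Y`.
  have hkspan := mem_span_of_norm_le_sum (C := ε * δ⁻¹) k (fun y : F => ev y) (by
    intro x
    refine (hk x).trans (le_of_eq ?_)
    rw [Finset.sum_coe_sort F (fun y => ‖ev y x‖), mul_assoc]
    change ε * (δ⁻¹ * Q x) = _
    rw [hQ]
    rfl)
  obtain ⟨c, hc⟩ := (Submodule.mem_span_range_iff_exists_fun 𝕜).1 hkspan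
  refine ⟨∑ i, c i • (i : Y), fun x hx => ?_⟩
  have hxS : x ∈ S := ⟨1, by rintro _ ⟨y, rfl⟩; exact (hx y).trans y.2⟩
  have h3 : f x = g ⟨x, hxS⟩ + k ⟨x, hxS⟩ := DFunLike.congr_fun hgk ⟨x, hxS⟩
  have h4 : k ⟨x, hxS⟩ = φ x (∑ i, c i • (i : Y)) := by
    rw [← hc]
    simp [ev]
  rw [h3, h4, add_sub_cancel_right]
  refine (hg _).trans ?_
  change ε * (⨆ y, P₁ y) ⟨x, hxS⟩ ≤ ε
  exact mul_le_of_le_one_right hε ((hP ⟨x, hxS⟩).2 hx)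

end DualBall

/-! ### Continuous seminorms and duals of locally convex spaces. -/

section LocallyConvex

variable {𝕜 : Type*} [RCLike 𝕜] {E : Type*} [AddCommGroup E] [Module 𝕜 E] [TopologicalSpace E]
  [IsTopologicalAddGroup E]

theorem continuous_dual_of_norm_le (f : Module.Dual 𝕜 E) {p : E → ℝ} (hp : Continuous p)
    (hp0 : p 0 = 0) (h : ∀ x, ‖f x‖ ≤ p x) : Continuous f := by
  refine continuous_of_continuousAt_zero f ?_
  rw [ContinuousAt, map_zero]
  exact squeeze_zero_norm h (hp0 ▸ hp.tendsto 0)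

variable [ContinuousSMul 𝕜 E] [LocallyConvexSpace 𝕜 E]

theorem exists_continuous_seminorm_le_one_subset {V : Set E} (hV : V ∈ 𝓝 (0 : E)) :
    ∃ p : Seminorm 𝕜 E, Continuous p ∧ {x | p x ≤ 1} ⊆ V := by
  let : Module ℝ E := .restrictScalars ℝ 𝕜 E
  have : IsScalarTower ℝ 𝕜 E := .restrictScalars _ _ _
  have : ContinuousSMul ℝ E := IsScalarTower.continuousSMul 𝕜
  obtain ⟨s, hs, hsV⟩ := (nhds_hasBasis_absConvex_open 𝕜 E).mem_iff.1 hV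
  let s' : AbsConvexOpenSets 𝕜 E := ⟨s, hs⟩
  have hc := (with_gaugeSeminormFamily (𝕜 := 𝕜) (E := E)).continuous_seminorm s'
  -- The open unit ball of the gauge is `s`; the factor `2` makes the closed unit ball fit inside
  -- it.
  refine ⟨(2 : NNReal) • gaugeSeminormFamily 𝕜 E s', hc.const_smul (2 : NNReal), fun x hx => hsV ?_⟩
  have h1 : 2 * gaugeSeminormFamily 𝕜 E s' x ≤ 1 := hx
  have h2 := gaugeSeminormFamily_ball s'
  change x ∈ (s' : Set E)
  rw [← h2, Seminorm.mem_ball_zero]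
  linarith

omit [LocallyConvexSpace 𝕜 E] [ContinuousSMul 𝕜 E] in
-- A Hahn–Banach functional dominated by `p` and equal to `p y` at `y` is continuous, hence
-- represented in the polar; thus `p` is recovered from its polar.
theorem seminorm_le_of_forall_dualBall {X : Type*} {φ : X → StrongDual 𝕜 E}
    (hφ : Function.Surjective φ) {p : Seminorm 𝕜 E} (hp : Continuous p) {y : E} {c : ℝ}
    (h : ∀ x ∈ dualBall φ p, ‖φ x y‖ ≤ c) : p y ≤ c := by
  obtain ⟨f, hf, hfy⟩ := exists_dual_le_seminorm_eq p y
  obtain ⟨x, hx⟩ := hφ ⟨f, continuous_dual_of_norm_le f hp (map_zero p) hf⟩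
  have := h x (fun z => by rw [hx]; exact hf z)
  rw [hx] at this
  change ‖f y‖ ≤ c at this
  rwa [hfy, RCLike.norm_ofReal, abs_of_nonneg (apply_nonneg p y)] at this

theorem eq_of_forall_dual_eq [T2Space E] {X : Type*} {φ : X → StrongDual 𝕜 E}
    (hφ : Function.Surjective φ) {y z : E} (h : ∀ x, φ x y = φ x z) : y = z := by
  by_contra hne
  have hV : {w : E | w ≠ y - z} ∈ 𝓝 (0 : E) :=
    isOpen_ne.mem_nhds (sub_ne_zero.2 hne).symm
  obtain ⟨p, hp, hpV⟩ := exists_continuous_seminorm_le_one_subset (𝕜 := 𝕜) hV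
  refine hpV (a := y - z) ?_ rfl
  exact seminorm_le_of_forall_dualBall hφ hp fun x _ => by simp [h x]

end LocallyConvex

/-! ### Banach–Steinhaus and equicontinuity. -/

section Barrelled

variable {𝕜 : Type*} [RCLike 𝕜] {X Y : Type*} [AddCommGroup Y] [Module 𝕜 Y] [UniformSpace Y]
  [IsUniformAddGroup Y] [ContinuousSMul 𝕜 Y]

theorem exists_subset_dualBall [BarrelledSpace 𝕜 Y] (φ : X → StrongDual 𝕜 Y) {B : Set X}
    (h : ∀ y, IsVonNBounded 𝕜 ((fun x => φ x y) '' B)) :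
    ∃ p : Seminorm 𝕜 Y, Continuous p ∧ B ⊆ dualBall φ p := by
  have hue := (norm_withSeminorms 𝕜 𝕜).banach_steinhaus (𝓕 := fun x : B => φ x) (by
    intro _ y
    obtain ⟨r, hr⟩ := (NormedSpace.isVonNBounded_iff' 𝕜).1 (h y)
    exact ⟨r, by rintro _ ⟨x, rfl⟩; exact hr _ ⟨x, x.2, rfl⟩⟩)
  obtain ⟨p, hp, hpB⟩ := ((norm_withSeminorms 𝕜 𝕜).uniformEquicontinuous_iff_exists_continuous_seminorm
    (fun x : B => (φ x : Y →ₗ[𝕜] 𝕜))).1 hue 0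
  exact ⟨p, hp, fun x hx y => hpB ⟨x, hx⟩ y⟩

theorem uniformEquicontinuous_dualBall (φ : X → StrongDual 𝕜 Y) {p : Seminorm 𝕜 Y}
    (hp : Continuous p) {B : Set X} (hB : B ⊆ dualBall φ p) :
    UniformEquicontinuous fun (x : B) (y : Y) => φ x y :=
  ((norm_withSeminorms 𝕜 𝕜).uniformEquicontinuous_iff_exists_continuous_seminorm
    (fun x : B => (φ x : Y →ₗ[𝕜] 𝕜))).2 fun _ => ⟨p, hp, fun x y => hB x.2 y⟩

end Barrelled

/-! ### Topologies of pointwise and compact convergence. -/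

section Topologies

variable {𝕜 : Type*} [RCLike 𝕜] {X Y : Type*} [AddCommGroup Y] [Module 𝕜 Y] [TopologicalSpace Y]

theorem sigmaTopology_eq_induced (φ : X → StrongDual 𝕜 Y) :
    sigmaTopology φ = Pi.topologicalSpace.induced fun x y => φ x y := by
  have h := (PointwiseConvergenceCLM.isEmbedding_coeFn (RingHom.id 𝕜) Y 𝕜).eq_induced
  have h' := congrArg (TopologicalSpace.induced fun x =>
    UniformConvergenceCLM.ofFun (RingHom.id 𝕜) 𝕜 {s : Set Y | Finite s} (φ x)) h
  rw [induced_compose] at h'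
  exact h'

theorem pairingTopology_eq_induced (φ : X → StrongDual 𝕜 Y) (𝔖 : Set (Set Y)) :
    pairingTopology φ 𝔖 = (UniformOnFun.topologicalSpace Y 𝕜 𝔖).induced
      fun x => UniformOnFun.ofFun 𝔖 (φ x) := by
  rw [pairingTopology, UniformConvergenceCLM.topologicalSpace_eq, induced_compose]
  rfl

theorem locallyConvexSpace_self (𝕜 : Type*) [RCLike 𝕜] : LocallyConvexSpace 𝕜 𝕜 :=
  LocallyConvexSpace.ofBasisZero 𝕜 𝕜 (fun r : ℝ => Metric.ball 0 r) (fun r => 0 < r)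
    Metric.nhds_basis_ball fun _ _ => convex_of_nonneg_surjective_algebraMap _
      (fun _ => RCLike.nonneg_iff_exists_ofReal.mp) (convex_ball _ _)

theorem compactTopology_le_sigmaTopology (φ : X → StrongDual 𝕜 Y) :
    compactTopology φ ≤ sigmaTopology φ :=
  induced_mono (UniformConvergenceCLM.topologicalSpace_mono _ _ fun _ h => Set.Finite.isCompact h)

theorem continuous_sigmaTopology_apply (φ : X → StrongDual 𝕜 Y) (y : Y) :
    Continuous[sigmaTopology φ, _] fun x => φ x y := by
  rw [sigmaTopology_eq_induced]
  let := Pi.topologicalSpace.induced fun (x : X) (y : Y) => φ x y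
  exact (continuous_apply y).comp continuous_induced_dom

/-- Alaoglu: the linear functions form a closed subset of the product of the discs of radius `p y`,
and each one in it is continuous because `p` dominates it. -/
theorem isCompact_dualBall (φ : X → StrongDual 𝕜 Y) (hφ : Function.Surjective φ)
    [IsTopologicalAddGroup Y] {p : Seminorm 𝕜 Y} (hp : Continuous p) :
    @IsCompact X (sigmaTopology φ) (dualBall φ p) := by
  rw [sigmaTopology_eq_induced]
  let := Pi.topologicalSpace.induced fun (x : X) (y : Y) => φ x y
  have hind : IsInducing fun (x : X) (y : Y) => φ x y := ⟨rfl⟩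
  rw [hind.isCompact_iff]
  have : (fun (x : X) (y : Y) => φ x y) '' dualBall φ p =
      (Set.univ.pi fun y => Metric.closedBall (0 : 𝕜) (p y)) ∩
        Set.range ((↑) : (Y →ₗ[𝕜] 𝕜) → Y → 𝕜) := by
    ext f
    constructor
    · rintro ⟨x, hx, rfl⟩
      exact ⟨fun y _ => by simpa using hx y, (φ x : Y →ₗ[𝕜] 𝕜), rfl⟩
    · rintro ⟨hf, f, rfl⟩
      have hf' : ∀ y, ‖f y‖ ≤ p y := fun y => by simpa using hf y trivial
      obtain ⟨x, hx⟩ := hφ ⟨f, continuous_dual_of_norm_le f hp (map_zero p) hf'⟩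
      refine ⟨x, ?_, ?_⟩
      · rw [dualBall, Set.mem_ofPred_eq, hx]
        exact hf'
      · exact funext fun y => DFunLike.congr_fun hx y
  rw [this]
  exact (isCompact_univ_pi fun y => isCompact_closedBall _ _).inter_right
    (LinearMap.isClosed_range_coe Y 𝕜 (RingHom.id 𝕜))

theorem isClosed_sigmaTopology_setOf_norm_le (φ : X → StrongDual 𝕜 Y) (S : Set Y) (r : Y → ℝ) :
    IsClosed[sigmaTopology φ] {x | ∀ y ∈ S, ‖φ x y‖ ≤ r y} := by
  let := sigmaTopology φ
  have : {x | ∀ y ∈ S, ‖φ x y‖ ≤ r y} = ⋂ y ∈ S, {x | ‖φ x y‖ ≤ r y} := by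
    ext; simp
  rw [this]
  exact isClosed_biInter fun y _ =>
    isClosed_le (continuous_sigmaTopology_apply φ y).norm continuous_const

variable [AddCommGroup X] [Module 𝕜 X]

theorem isLCHausdorff_pairingTopology (φ : X →ₗ[𝕜] StrongDual 𝕜 Y) (hφ : Function.Injective φ)
    {𝔖 : Set (Set Y)} (hne : 𝔖.Nonempty) (hdir : DirectedOn (· ⊆ ·) 𝔖)
    (hcov : ⋃₀ 𝔖 = Set.univ) (hbdd : ∀ S ∈ 𝔖, IsVonNBounded 𝕜 S) :
    IsLCHausdorff 𝕜 (pairingTopology φ 𝔖) := by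
  let φ' : X →ₗ[𝕜] UniformConvergenceCLM (RingHom.id 𝕜) 𝕜 𝔖 :=
    (ContinuousLinearMap.toUniformConvergenceCLM (RingHom.id 𝕜) 𝕜 𝔖).toLinearMap ∘ₗ φ
  have hφ' : Function.Injective φ' := hφ
  have : ContinuousSMul 𝕜 (UniformConvergenceCLM (RingHom.id 𝕜) 𝕜 𝔖) :=
    UniformConvergenceCLM.continuousSMul _ _ _ hbdd
  have := locallyConvexSpace_self 𝕜
  have : LocallyConvexSpace 𝕜 (UniformConvergenceCLM (RingHom.id 𝕜) 𝕜 𝔖) :=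
    UniformConvergenceCLM.locallyConvexSpace 𝕜 𝔖 hne hdir
  have : T2Space (UniformConvergenceCLM (RingHom.id 𝕜) 𝕜 𝔖) :=
    UniformConvergenceCLM.t2Space _ _ _ hcov
  change IsLCHausdorff 𝕜 (TopologicalSpace.induced φ' _)
  refine ⟨topologicalAddGroup_induced φ', continuousSMul_induced φ',
    LocallyConvexSpace.induced φ', ?_⟩
  exact @T2Space.of_injective_continuous _ _ (_) _ _ _ hφ' continuous_induced_dom

theorem isLCHausdorff_sigmaTopology [ContinuousSMul 𝕜 Y]
    (φ : X →ₗ[𝕜] StrongDual 𝕜 Y) (hφ : Function.Injective φ) :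
    IsLCHausdorff 𝕜 (sigmaTopology φ) :=
  isLCHausdorff_pairingTopology φ hφ ⟨∅, Set.finite_empty⟩
    (directedOn_of_sup_mem fun _ _ => Set.Finite.union) Set.sUnion_finite_eq_univ
    fun _ => Set.Finite.isVonNBounded

theorem isLCHausdorff_compactTopology [IsTopologicalAddGroup Y] [ContinuousSMul 𝕜 Y]
    (φ : X →ₗ[𝕜] StrongDual 𝕜 Y) (hφ : Function.Injective φ) :
    IsLCHausdorff 𝕜 (compactTopology φ) :=
  isLCHausdorff_pairingTopology φ hφ ⟨∅, isCompact_empty⟩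
    (directedOn_of_sup_mem fun _ _ => IsCompact.union) Set.sUnion_isCompact_eq_univ
    fun _ h => h.isVonNBounded 𝕜

theorem absConvex_setOf_norm_le (φ : X →ₗ[𝕜] StrongDual 𝕜 Y) (S : Set Y) (r : Y → ℝ) :
    AbsConvex 𝕜 {x | ∀ y ∈ S, ‖φ x y‖ ≤ r y} := by
  constructor
  · rw [balanced_iff_smul_mem]
    intro a ha x hx y hy
    rw [map_smul]
    exact (norm_smul_le _ _).trans ((mul_le_of_le_one_left (norm_nonneg _) ha).trans (hx y hy))
  · intro x hx z hz a b ha hb hab y hy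
    have ha' : ((‖a‖ : ℝ) : 𝕜) = a := RCLike.norm_of_nonneg' ha
    have hb' : ((‖b‖ : ℝ) : 𝕜) = b := RCLike.norm_of_nonneg' hb
    have hab' : ‖a‖ + ‖b‖ = 1 := by
      rw [← ha', ← hb'] at hab
      exact_mod_cast hab
    calc ‖φ (a • x + b • z) y‖ = ‖a * φ x y + b * φ z y‖ := by simp
      _ ≤ ‖a‖ * r y + ‖b‖ * r y := by
        refine (norm_add_le _ _).trans ?_
        rw [norm_mul, norm_mul]
        have := hx y hy
        have := hz y hy
        gcongr
      _ = r y := by rw [← add_mul, hab', one_mul]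

theorem absConvex_dualBall (φ : X →ₗ[𝕜] StrongDual 𝕜 Y) (p : Seminorm 𝕜 Y) :
    AbsConvex 𝕜 (dualBall φ p) := by
  simpa [dualBall] using absConvex_setOf_norm_le φ Set.univ p

end Topologies

/-! ### Topologies that agree on a subset. -/

section CoincidingTopologies

theorem continuousOn_of_induced_eq {X Z : Type*} [TopologicalSpace Z] {t t' : TopologicalSpace X}
    {B : Set X} (h : t.induced (Subtype.val : B → X) = t'.induced (Subtype.val : B → X))
    {f : X → Z} (hf : @ContinuousOn X Z t _ f B) : @ContinuousOn X Z t' _ f B := by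
  rw [@continuousOn_iff_continuous_domRestrict X Z t] at hf
  rw [@continuousOn_iff_continuous_domRestrict X Z t']
  change @Continuous B Z (t'.induced Subtype.val) _ _
  rw [← h]
  exact hf

theorem isCompact_of_induced_eq {X : Type*} {t t' : TopologicalSpace X}
    {B : Set X} (h : t.induced (Subtype.val : B → X) = t'.induced (Subtype.val : B → X))
    (hB : @IsCompact X t B) : @IsCompact X t' B := by
  rw [@isCompact_iff_compactSpace X t] at hB
  rw [@isCompact_iff_compactSpace X t']
  change @CompactSpace B (t'.induced Subtype.val)
  rw [← h]
  exact hB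

end CoincidingTopologies

variable {𝕜 : Type*} [RCLike 𝕜] {X Y : Type*} [AddCommGroup X] [Module 𝕜 X]

theorem hasBasis_nhds_zero_pairingTopology [AddCommGroup Y] [Module 𝕜 Y] [TopologicalSpace Y]
    (φ : X →ₗ[𝕜] StrongDual 𝕜 Y) {𝔖 : Set (Set Y)} (hne : 𝔖.Nonempty)
    (hdir : DirectedOn (· ⊆ ·) 𝔖) :
    (@nhds X (pairingTopology φ 𝔖) 0).HasBasis (fun Sr : Set Y × ℝ => Sr.1 ∈ 𝔖 ∧ 0 < Sr.2)
      fun Sr => {x | ∀ y ∈ Sr.1, ‖φ x y‖ ≤ Sr.2} := by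
  have h := UniformConvergenceCLM.hasBasis_nhds_zero_of_basis (RingHom.id 𝕜) 𝕜 𝔖 hne hdir
    (Metric.nhds_basis_closedBall (x := (0 : 𝕜)))
  rw [pairingTopology, nhds_induced]
  have h0 : UniformConvergenceCLM.ofFun (RingHom.id 𝕜) 𝕜 𝔖 (φ 0) = 0 := by
    rw [map_zero]; rfl
  rw [h0]
  convert! h.comap (fun x => UniformConvergenceCLM.ofFun (RingHom.id 𝕜) 𝕜 𝔖 (φ x)) using 2
  ext x
  simp only [Set.mem_ofPred_eq, Set.mem_preimage, mem_closedBall_zero_iff]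
  rfl

variable [AddCommGroup Y] [Module 𝕜 Y] [UniformSpace Y] [IsUniformAddGroup Y] [ContinuousSMul 𝕜 Y]

omit [AddCommGroup X] [Module 𝕜 X] in
-- On an equicontinuous family, pointwise convergence is already uniform on compact sets.
theorem induced_compactTopology_eq_of_subset_dualBall (φ : X → StrongDual 𝕜 Y) {p : Seminorm 𝕜 Y}
    (hp : Continuous p) {B : Set X} (hB : B ⊆ dualBall φ p) :
    (compactTopology φ).induced (Subtype.val : B → X) =
      (sigmaTopology φ).induced (Subtype.val : B → X) := by
  rw [sigmaTopology_eq_induced, compactTopology, pairingTopology_eq_induced, induced_compose,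
    induced_compose]
  let : TopologicalSpace B := Pi.topologicalSpace.induced fun (x : B) (y : Y) => φ x y
  refine ((EquicontinuousOn.isInducing_uniformOnFun_iff_pi
    (F := fun (x : B) (y : Y) => φ x y) Set.sUnion_isCompact_eq_univ (fun _ h => h)
    fun K _ => ?_).2 ⟨rfl⟩).eq_induced.symm
  exact (uniformEquicontinuous_dualBall φ hp hB).equicontinuous.equicontinuousOn K

/-! ### Grothendieck's completeness theorem and compact polars in `Y`. -/

section Complete

variable [LocallyConvexSpace 𝕜 Y] [CompleteSpace Y]

/-- **Grothendieck's completeness theorem**: a linear functional on the dual of a complete locally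
convex space that is weakly continuous on equicontinuous sets is an evaluation. -/
theorem exists_eq_eval_of_continuousOn_dualBall (φ : X →ₗ[𝕜] StrongDual 𝕜 Y)
    (hφ : Function.Surjective φ) (f : Module.Dual 𝕜 X)
    (hf : ∀ p : Seminorm 𝕜 Y, Continuous p →
      @ContinuousOn X 𝕜 (sigmaTopology φ) _ f (dualBall φ p)) :
    ∃ y, ∀ x, f x = φ x y := by
  -- The fixed error `1 / 2` suffices: two errors add up to `1`, which gives the Cauchy property,
  -- and a linear functional bounded by `1 / 2` on all of `X` is zero.
  let A : {p : Seminorm 𝕜 Y // Continuous p} → Set Y := fun p =>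
    {y | ∀ x ∈ dualBall φ p.1, ‖f x - φ x y‖ ≤ 1 / 2}
  have hA : ∀ p, (A p).Nonempty := by
    rintro ⟨p, hp⟩
    have h1 : {x | ‖f x‖ ≤ 1 / 2} ∈ @nhdsWithin X (sigmaTopology φ) 0 (dualBall φ p) := by
      have h0 : (0 : X) ∈ dualBall φ p := fun y => by simp
      refine (hf p hp 0 h0) (?_ : {c : 𝕜 | ‖c‖ ≤ 1 / 2} ∈ 𝓝 (f 0))
      rw [map_zero]
      filter_upwards [Metric.closedBall_mem_nhds (0 : 𝕜) (one_half_pos (α := ℝ))] with c hc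
      simpa using hc
    have hb := hasBasis_nhds_zero_pairingTopology φ (𝔖 := {N | N.Finite}) ⟨∅, Set.finite_empty⟩
      (directedOn_of_sup_mem fun _ _ => Set.Finite.union)
    obtain ⟨⟨F, δ⟩, ⟨hF, hδ⟩, hFδ⟩ := (hb.inf_principal (dualBall φ p)).mem_iff.1 h1
    obtain ⟨F, rfl⟩ := Set.Finite.exists_finset_coe hF
    exact exists_norm_sub_le_on_dualBall φ p f hδ F fun x hx hxF => hFδ ⟨hxF, hx⟩
  have hmono : ∀ p q : {p : Seminorm 𝕜 Y // Continuous p}, p ≤ q → A q ⊆ A p :=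
    fun p q hpq y hy x hx => hy x fun z => (hx z).trans (hpq z)
  let l : Filter Y := ⨅ p, Filter.principal (A p)
  have hl : ∀ p, A p ∈ l := fun p => Filter.mem_iInf_of_mem p (Filter.mem_principal_self _)
  have : Nonempty {p : Seminorm 𝕜 Y // Continuous p} := ⟨⟨0, continuous_const⟩⟩
  have hdir : Directed (· ≥ ·) fun p => Filter.principal (A p) := by
    intro p q
    refine ⟨⟨p.1 + q.1, p.2.add q.2⟩, ?_, ?_⟩ <;> refine Filter.principal_mono.2 (hmono _ _ ?_)
    · exact fun y => le_add_of_nonneg_right (apply_nonneg q.1 y)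
    · exact fun y => le_add_of_nonneg_left (apply_nonneg p.1 y)
  have hne : l.NeBot :=
    Filter.iInf_neBot_of_directed hdir fun p => Filter.principal_neBot_iff.2 (hA p)
  have hc : Cauchy l := by
    refine cauchy_iff.2 ⟨hne, fun V hV => ?_⟩
    rw [uniformity_eq_comap_nhds_zero, Filter.mem_comap] at hV
    obtain ⟨W, hW, hWV⟩ := hV
    obtain ⟨p, hp, hpW⟩ := exists_continuous_seminorm_le_one_subset (𝕜 := 𝕜) hW
    refine ⟨A ⟨p, hp⟩, hl _, ?_⟩
    rintro ⟨a, b⟩ ⟨ha, hb⟩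
    refine hWV (hpW (seminorm_le_of_forall_dualBall hφ hp fun x hx => ?_))
    have h1 := norm_sub_le (f x - φ x a) (f x - φ x b)
    have h2 : f x - φ x a - (f x - φ x b) = φ x (b - a) := by
      rw [map_sub]; ring
    rw [h2] at h1
    have := ha x hx
    have := hb x hx
    linarith
  obtain ⟨y, hy⟩ := CompleteSpace.complete hc
  refine ⟨y, ?_⟩
  let ev : Module.Dual 𝕜 X :=
    { toFun := fun x => φ x y
      map_add' := fun _ _ => by simp
      map_smul' := fun _ _ => by simp }
  have hle : ∀ x, ‖(f - ev) x‖ ≤ 1 / 2 := by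
    intro x
    -- The polar of this seminorm contains `x` itself.
    let p : Seminorm 𝕜 Y := (normSeminorm 𝕜 𝕜).comp (φ x : Y →ₗ[𝕜] 𝕜)
    have hp : Continuous p := (φ x).continuous.norm
    have hclosed : IsClosed {z : Y | ‖f x - φ x z‖ ≤ 1 / 2} :=
      isClosed_le (continuous_const.sub (φ x).continuous).norm continuous_const
    have hz : ∀ᶠ z in l, z ∈ {z : Y | ‖f x - φ x z‖ ≤ 1 / 2} := by
      filter_upwards [hl ⟨p, hp⟩] with z hz
      exact hz x fun w => le_rfl
    have hyc : y ∈ {z : Y | ‖f x - φ x z‖ ≤ 1 / 2} :=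
      hclosed.mem_of_tendsto (b := l) (f := id) hy hz
    exact hyc
  intro x
  have := norm_le_mul_seminorm (f - ev) 0 (fun x _ => hle x) x
  simp only [zero_apply, mul_zero, norm_le_zero_iff] at this
  exact sub_eq_zero.1 this

variable [TopologicalSpace X] [IsTopologicalAddGroup X]

omit [IsTopologicalAddGroup X] in
theorem exists_eq_eval_of_continuous (φ : X →ₗ[𝕜] StrongDual 𝕜 Y) (hφ : Function.Surjective φ)
    (hco : ∀ p : Seminorm 𝕜 Y, Continuous p →
      ‹TopologicalSpace X›.induced (Subtype.val : dualBall φ p → X) =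
        (sigmaTopology φ).induced Subtype.val)
    (f : Module.Dual 𝕜 X) (hf : Continuous f) : ∃ y, ∀ x, f x = φ x y :=
  exists_eq_eval_of_continuousOn_dualBall φ hφ f fun p hp =>
    continuousOn_of_induced_eq (hco p hp) hf.continuousOn

/-- An ultrafilter on the set converges pointwise on `X` to a functional dominated by `q`, which is
evaluation at some `y` by Grothendieck's theorem. Convergence in `Y` is uniform convergence on
polars; these are compact and the functionals are `q`-equicontinuous, so Ascoli's argument applies.
-/
theorem isCompact_setOf_norm_le_seminorm (φ : X →ₗ[𝕜] StrongDual 𝕜 Y) (hφ : Function.Surjective φ)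
    (hco : ∀ p : Seminorm 𝕜 Y, Continuous p →
      ‹TopologicalSpace X›.induced (Subtype.val : dualBall φ p → X) =
        (sigmaTopology φ).induced Subtype.val)
    (q : Seminorm 𝕜 X) (hq : Continuous q) :
    IsCompact {y | ∀ x, ‖φ x y‖ ≤ q x} := by
  rw [isCompact_iff_ultrafilter_le_nhds]
  intro u hu
  have hu' : ∀ᶠ y in (u : Filter Y), ∀ x, ‖φ x y‖ ≤ q x := hu (Filter.mem_principal_self _)
  have hlim : ∀ x, ∃ c, ‖c‖ ≤ q x ∧ Filter.Tendsto (fun y => φ x y) u (𝓝 c) := by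
    intro x
    have hmem : ∀ᶠ y in (u : Filter Y), φ x y ∈ Metric.closedBall (0 : 𝕜) (q x) := by
      filter_upwards [hu'] with y hy
      simpa using hy x
    obtain ⟨c, hc, hcu⟩ := isCompact_iff_ultrafilter_le_nhds.1
      (isCompact_closedBall (0 : 𝕜) (q x)) (u.map fun y => φ x y)
      (Filter.le_principal_iff.2 hmem)
    exact ⟨c, by simpa using hc, hcu⟩
  choose g hgq hg using hlim
  let f : Module.Dual 𝕜 X :=
    { toFun := g
      map_add' := fun a b => tendsto_nhds_unique (hg (a + b))
        (((hg a).add (hg b)).congr fun y => by simp)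
      map_smul' := fun c a => tendsto_nhds_unique (hg (c • a))
        (((hg a).const_smul c).congr fun y => by simp) }
  obtain ⟨y, hy⟩ := exists_eq_eval_of_continuous φ hφ hco f
    (continuous_dual_of_norm_le f hq (map_zero q) hgq)
  have hyq : ∀ x, ‖φ x y‖ ≤ q x := fun x => hy x ▸ hgq x
  refine ⟨y, hyq, fun V hV => ?_⟩
  have hV' : (fun z => z + y) ⁻¹' V ∈ 𝓝 (0 : Y) :=
    (continuous_add_const y).continuousAt (by simpa using hV)
  obtain ⟨p, hp, hpV⟩ := exists_continuous_seminorm_le_one_subset (𝕜 := 𝕜) hV'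
  have hK : IsCompact (dualBall φ p) :=
    isCompact_of_induced_eq (hco p hp).symm (isCompact_dualBall φ hφ hp)
  -- The bound `1` is split into thirds: one for the values at the finite set `T`, two for moving
  -- from `x` to a point of `T` under `z` and under `y`.
  obtain ⟨T, -, hT⟩ := hK.elim_nhds_subcover (fun x => {x' | q (x' - x) < 1 / 3}) fun x _ =>
    (isOpen_lt (hq.comp (continuous_sub_right x)) continuous_const).mem_nhds (by simp)
  have hTu : ∀ᶠ z in (u : Filter Y), ∀ x ∈ T, ‖φ x z - φ x y‖ < 1 / 3 := by
    refine (Filter.eventually_all_finset T).2 fun x _ => ?_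
    have := (hg x).sub_const (φ x y)
    have h0 : g x - φ x y = 0 := sub_eq_zero.2 (hy x)
    rw [h0] at this
    simpa using this.eventually (Metric.ball_mem_nhds (0 : 𝕜) (by norm_num : (0 : ℝ) < 1 / 3))
  filter_upwards [hTu, hu'] with z hz hzq
  have : p (z - y) ≤ 1 := by
    refine seminorm_le_of_forall_dualBall hφ hp fun x hx => ?_
    obtain ⟨x', hx', hxx'⟩ := Set.mem_iUnion₂.1 (hT hx)
    have hxx'' : q (x - x') < 1 / 3 := hxx'
    have h1 := hz x' hx'
    have h2 := hzq (x - x')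
    have h3 := hyq (x - x')
    have h4 : φ x (z - y) = φ (x - x') z + (φ x' z - φ x' y) - φ (x - x') y := by
      simp only [map_sub, sub_apply]
      ring
    rw [h4]
    have h5 := norm_sub_le (φ (x - x') z + (φ x' z - φ x' y)) (φ (x - x') y)
    have h6 := norm_add_le (φ (x - x') z) (φ x' z - φ x' y)
    linarith
  simpa using hpV this

theorem compactTopology_le_of_induced_eq [ContinuousSMul 𝕜 X] [LocallyConvexSpace 𝕜 X]
    (φ : X ≃ₗ[𝕜] StrongDual 𝕜 Y)
    (hco : ∀ p : Seminorm 𝕜 Y, Continuous p →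
      ‹TopologicalSpace X›.induced (Subtype.val : dualBall φ p → X) =
        (sigmaTopology φ).induced Subtype.val) :
    compactTopology φ ≤ ‹TopologicalSpace X› := by
  have hc := (isLCHausdorff_compactTopology (φ : X →ₗ[𝕜] StrongDual 𝕜 Y)
    φ.injective).isTopologicalAddGroup
  rw [← continuous_id_iff_le]
  refine @continuous_of_continuousAt_zero X (compactTopology φ) _ hc X _ _ _ _ _ _
    (AddMonoidHom.id X) fun V hV => ?_
  obtain ⟨q, hq, hqV⟩ := exists_continuous_seminorm_le_one_subset (𝕜 := 𝕜) hV
  have hN := isCompact_setOf_norm_le_seminorm (φ : X →ₗ[𝕜] StrongDual 𝕜 Y) φ.surjective hco q hq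
  refine Filter.mem_of_superset ((hasBasis_nhds_zero_pairingTopology
    (φ : X →ₗ[𝕜] StrongDual 𝕜 Y) (𝔖 := {N | IsCompact N}) ⟨∅, isCompact_empty⟩
    (directedOn_of_sup_mem fun _ _ => IsCompact.union)).mem_of_mem
      (i := (_, 1)) ⟨hN, one_pos⟩) fun x hx => hqV ?_
  obtain ⟨f, hf, hfx⟩ := exists_dual_le_seminorm_eq q x
  obtain ⟨y, hy⟩ := exists_eq_eval_of_continuous (φ : X →ₗ[𝕜] StrongDual 𝕜 Y) φ.surjective hco f
    (continuous_dual_of_norm_le f hq (map_zero q) hf)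
  have := hx y fun z => hy z ▸ hf z
  rw [← hy, hfx, RCLike.norm_ofReal, abs_of_nonneg (apply_nonneg q x)] at this
  exact this

end Complete

/-! ### Bounded sets, (BBC), (CNC) and the mixed topology. -/

section Bounded

variable {𝕜 : Type*} [RCLike 𝕜] {X Y : Type*} [AddCommGroup X] [Module 𝕜 X]
  [τ : TopologicalSpace X] [AddCommGroup Y] [Module 𝕜 Y]

theorem isVonNBounded_dualBall [TopologicalSpace Y] (φ : X ≃L[𝕜] StrongDual 𝕜 Y)
    {p : Seminorm 𝕜 Y} (hp : Continuous p) : IsVonNBounded 𝕜 (dualBall φ p) := by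
  have h : IsVonNBounded 𝕜 (φ '' dualBall φ p) := by
    refine ContinuousLinearMap.isVonNBounded_iff.2 fun S hS => ?_
    obtain ⟨r, hr⟩ : BddAbove (p '' S) := by
      have := hS (Metric.isOpen_ball.preimage hp |>.mem_nhds
        (show (0 : Y) ∈ p ⁻¹' Metric.ball 0 1 by simp))
      obtain ⟨c, hc, hc0⟩ := (this.and (eventually_ne_cobounded 0)).exists
      refine ⟨‖c‖, ?_⟩
      rintro _ ⟨y, hy, rfl⟩
      obtain ⟨z, hz, rfl⟩ := hc hy
      have hz' : p z ≤ 1 := by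
        have : |p z| < 1 := by simpa using hz
        exact (le_abs_self _).trans this.le
      simpa [map_smul_eq_mul] using mul_le_of_le_one_right (norm_nonneg c) hz'
    refine (NormedSpace.isVonNBounded_iff' 𝕜).2 ⟨r, ?_⟩
    rintro _ ⟨_, ⟨x, hx, rfl⟩, y, hy, rfl⟩
    exact (hx y).trans (hr ⟨y, hy, rfl⟩)
  have h2 := h.image (φ.symm : StrongDual 𝕜 Y →L[𝕜] X)
  rw [Set.image_image] at h2
  simpa using h2

variable [UniformSpace Y] [IsUniformAddGroup Y] [ContinuousSMul 𝕜 Y] [BarrelledSpace 𝕜 Y]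

omit τ in
theorem exists_subset_dualBall_of_isBddFor_sigmaTopology (φ : X →ₗ[𝕜] StrongDual 𝕜 Y)
    {B : Set X} (hB : IsBddFor 𝕜 (sigmaTopology φ) B) :
    ∃ p : Seminorm 𝕜 Y, Continuous p ∧ B ⊆ dualBall φ p := by
  refine exists_subset_dualBall φ fun y => ?_
  let := sigmaTopology φ
  let ev : X →L[𝕜] 𝕜 :=
    { toFun := fun x => φ x y
      map_add' := fun _ _ => by simp
      map_smul' := fun _ _ => by simp
      cont := continuous_sigmaTopology_apply φ y }
  exact IsVonNBounded.image hB ev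

omit [BarrelledSpace 𝕜 Y] in
theorem topology_le_compactTopology (φ : X ≃L[𝕜] StrongDual 𝕜 Y) :
    τ ≤ compactTopology φ := by
  refine φ.toHomeomorph.isInducing.eq_induced.le.trans ?_
  exact induced_mono (UniformConvergenceCLM.topologicalSpace_mono _ _
    fun _ h => IsCompact.isVonNBounded 𝕜 h)

/-- Boundedness weakens as the topology coarsens, and Banach–Steinhaus closes the loop:
`σ_φ`-bounded sets lie in polars, which are `τ`-bounded. -/
theorem isBddFor_iff_exists_subset_dualBall (φ : X ≃L[𝕜] StrongDual 𝕜 Y) :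
    ∀ {t : TopologicalSpace X}, τ ≤ t → t ≤ sigmaTopology φ → ∀ {B : Set X},
      IsBddFor 𝕜 t B ↔ ∃ p : Seminorm 𝕜 Y, Continuous p ∧ B ⊆ dualBall φ p := by
  have h₁ := fun B => exists_subset_dualBall_of_isBddFor_sigmaTopology (B := B)
    (φ.toLinearEquiv : X →ₗ[𝕜] StrongDual 𝕜 Y)
  have h₂ : ∀ p : Seminorm 𝕜 Y, Continuous p → ∀ B ⊆ dualBall φ p, IsVonNBounded 𝕜 B :=
    fun p hp _ hB => (isVonNBounded_dualBall φ hp).subset hB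
  refine fun {_} hτ hσ _ => ⟨fun hB => h₁ _ (IsVonNBounded.of_topologicalSpace_le hσ hB), ?_⟩
  rintro ⟨p, hp, hB⟩
  exact IsVonNBounded.of_topologicalSpace_le hτ (h₂ p hp _ hB)

omit [BarrelledSpace 𝕜 Y] in
theorem topology_le_sigmaTopology (φ : X ≃L[𝕜] StrongDual 𝕜 Y) :
    τ ≤ sigmaTopology φ :=
  (topology_le_compactTopology φ).trans (compactTopology_le_sigmaTopology φ)

theorem sameBdd_compactTopology (φ : X ≃L[𝕜] StrongDual 𝕜 Y) :
    SameBdd 𝕜 τ (compactTopology φ) := fun _ =>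
  (isBddFor_iff_exists_subset_dualBall φ le_rfl (topology_le_sigmaTopology φ)).trans
    (isBddFor_iff_exists_subset_dualBall φ (topology_le_compactTopology φ)
      (compactTopology_le_sigmaTopology φ)).symm

theorem bbc_sigmaTopology (φ : X ≃L[𝕜] StrongDual 𝕜 Y) :
    BBC 𝕜 τ (sigmaTopology φ) := by
  refine ⟨isLCHausdorff_sigmaTopology (φ.toLinearEquiv : X →ₗ[𝕜] StrongDual 𝕜 Y) φ.injective,
    fun B hB => ?_⟩
  obtain ⟨p, hp, hBp⟩ := (isBddFor_iff_exists_subset_dualBall φ le_rfl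
    (topology_le_sigmaTopology φ)).1 hB
  exact ⟨dualBall φ p, hBp, absConvex_dualBall (φ.toLinearEquiv : X →ₗ[𝕜] StrongDual 𝕜 Y) p,
    isVonNBounded_dualBall φ hp, isCompact_dualBall φ φ.surjective hp⟩

omit [UniformSpace Y] [IsUniformAddGroup Y] [ContinuousSMul 𝕜 Y] [BarrelledSpace 𝕜 Y] in
-- The basis consists of polars of bounded subsets of `Y`, which are intersections of `σ_φ`-closed
-- sets.
theorem cnc_sigmaTopology [TopologicalSpace Y] [ContinuousSMul 𝕜 Y]
    (φ : X ≃L[𝕜] StrongDual 𝕜 Y) : CNC 𝕜 τ (sigmaTopology φ) := by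
  refine ⟨isLCHausdorff_sigmaTopology (φ.toLinearEquiv : X →ₗ[𝕜] StrongDual 𝕜 Y) φ.injective,
    {U | ∃ Sr : Set Y × ℝ, (IsVonNBounded 𝕜 Sr.1 ∧ 0 < Sr.2) ∧
      U = {x | ∀ y ∈ Sr.1, ‖φ x y‖ ≤ Sr.2}}, ?_, ?_⟩
  · rintro _ ⟨Sr, -, rfl⟩
    exact ⟨absConvex_setOf_norm_le (φ.toLinearEquiv : X →ₗ[𝕜] StrongDual 𝕜 Y) Sr.1 fun _ => Sr.2,
      isClosed_sigmaTopology_setOf_norm_le φ Sr.1 fun _ => Sr.2⟩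
  · have h : (𝓝 (0 : X)).HasBasis (fun Sr : Set Y × ℝ => IsVonNBounded 𝕜 Sr.1 ∧ 0 < Sr.2)
        fun Sr => {x | ∀ y ∈ Sr.1, ‖φ x y‖ ≤ Sr.2} := by
      have hb := hasBasis_nhds_zero_pairingTopology (φ.toLinearEquiv : X →ₗ[𝕜] StrongDual 𝕜 Y)
        (𝔖 := {S | IsVonNBounded 𝕜 S}) ⟨∅, isVonNBounded_empty 𝕜 Y⟩
        (directedOn_of_sup_mem fun _ _ => IsVonNBounded.union)
      have : τ = pairingTopology φ {S | IsVonNBounded 𝕜 S} :=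
        φ.toHomeomorph.isInducing.eq_induced
      rwa [show pairingTopology (φ.toLinearEquiv : X →ₗ[𝕜] StrongDual 𝕜 Y)
        {S | IsVonNBounded 𝕜 S} = τ from this.symm] at hb
    refine h.to_hasBasis (fun Sr hSr => ⟨_, ⟨Sr, hSr, rfl⟩, subset_rfl⟩) ?_
    rintro _ ⟨Sr, hSr, rfl⟩
    exact ⟨Sr, hSr, subset_rfl⟩

theorem coincideOnBdd_compactTopology (φ : X ≃L[𝕜] StrongDual 𝕜 Y) :
    CoincideOnBdd 𝕜 τ (sigmaTopology φ) (compactTopology φ) := by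
  intro B hB
  obtain ⟨p, hp, hBp⟩ := (isBddFor_iff_exists_subset_dualBall φ le_rfl
    (topology_le_sigmaTopology φ)).1 hB
  exact induced_compactTopology_eq_of_subset_dualBall φ hp hBp

theorem mixedTopologyOf_eq_compactTopology [LocallyConvexSpace 𝕜 Y] [CompleteSpace Y]
    (φ : X ≃L[𝕜] StrongDual 𝕜 Y) :
    mixedTopologyOf τ φ = compactTopology φ := by
  have hleast := isLeast_mixedTopology 𝕜 τ (isLCHausdorff_sigmaTopology
    (φ.toLinearEquiv : X →ₗ[𝕜] StrongDual 𝕜 Y) φ.injective)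
  refine le_antisymm (hleast.2 ⟨isLCHausdorff_compactTopology
    (φ.toLinearEquiv : X →ₗ[𝕜] StrongDual 𝕜 Y) φ.injective, coincideOnBdd_compactTopology φ⟩) ?_
  obtain ⟨⟨h₁, h₂, h₃, -⟩, h₄⟩ := hleast.1
  exact @compactTopology_le_of_induced_eq 𝕜 _ X Y _ _ _ _ _ _ _ _ _ (_) h₁ h₂ h₃ φ.toLinearEquiv
    fun p hp => h₄ _ (isVonNBounded_dualBall φ hp)

end Bounded

/-! ### Duals of `X` with the topology of compact convergence. -/

section Duality

variable {𝕜 : Type*} [RCLike 𝕜] {X Y : Type*} [AddCommGroup X] [Module 𝕜 X]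
  [TopologicalSpace X] [AddCommGroup Y] [Module 𝕜 Y] [UniformSpace Y] [IsUniformAddGroup Y]
  [ContinuousSMul 𝕜 Y]

/-- A vector space with a copy of its topology. -/
def withTopologyCLE (t : TopologicalSpace X) : @ContinuousLinearEquiv 𝕜 𝕜 _ _ (RingHom.id 𝕜)
    (RingHom.id 𝕜) _ _ X t _ (WithTopology X t) _ _ _ _ :=
  let := t
  { toFun := WithTopology.toTopology t
    invFun := WithTopology.ofTopology
    map_add' := fun _ _ => rfl
    map_smul' := fun _ _ => rfl
    left_inv := fun _ => rfl
    right_inv := fun _ => rfl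
    continuous_toFun := WithTopology.continuous_toTopology t
    continuous_invFun := WithTopology.continuous_ofTopology t }

omit [TopologicalSpace X] in
theorem isVonNBounded_withTopology_iff {t : TopologicalSpace X} {B : Set (WithTopology X t)} :
    IsVonNBounded 𝕜 B ↔ IsBddFor 𝕜 t (WithTopology.toTopology t ⁻¹' B) := by
  let := t
  let e := withTopologyCLE (𝕜 := 𝕜) t
  constructor
  · intro h
    have := h.image (e.symm : WithTopology X t →L[𝕜] X)
    rwa [show (e.symm : WithTopology X t →L[𝕜] X) '' B = WithTopology.toTopology t ⁻¹' B from
      WithTopology.image_ofTopology t B] at this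
  · intro h
    have := IsVonNBounded.image h (e : X →L[𝕜] WithTopology X t)
    rwa [show (e : X →L[𝕜] WithTopology X t) '' (WithTopology.toTopology t ⁻¹' B) = B from
      Set.image_preimage_eq _ (WithTopology.toTopology_surjective t)] at this

/-- `φ` as an isomorphism between `X` with `τ_{c,φ}(X, Y)` and `Y'` with `τ_c(Y', Y)`. -/
def compactTopologyCLE (φ : X ≃L[𝕜] StrongDual 𝕜 Y) :
    WithTopology X (compactTopology φ) ≃L[𝕜] (Y →L_c[𝕜] 𝕜) where
  toFun x := UniformConvergenceCLM.ofFun (RingHom.id 𝕜) 𝕜 {N | IsCompact N}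
    (φ (WithTopology.ofTopology x))
  invFun y' := WithTopology.toTopology _
    (φ.symm ((UniformConvergenceCLM.ofFun (RingHom.id 𝕜) 𝕜 {N | IsCompact N}).symm y'))
  map_add' x z := map_add φ (WithTopology.ofTopology x) (WithTopology.ofTopology z)
  map_smul' c x := map_smul φ c (WithTopology.ofTopology x)
  left_inv x := by simp
  right_inv y' := by simp
  continuous_toFun := by
    let := compactTopology φ
    exact Continuous.comp (g := fun x => UniformConvergenceCLM.ofFun (RingHom.id 𝕜) 𝕜
      {N | IsCompact N} (φ x)) continuous_induced_dom (WithTopology.continuous_ofTopology _)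
  continuous_invFun := by
    let := compactTopology φ
    refine (WithTopology.continuous_toTopology _).comp (continuous_induced_rng.2 ?_)
    convert! continuous_id using 1
    ext y'
    simp

end Duality

section Duality

variable {𝕜 : Type*} [RCLike 𝕜] {X Y : Type*} [AddCommGroup X] [Module 𝕜 X]
  [τ : TopologicalSpace X] [AddCommGroup Y] [Module 𝕜 Y] [UniformSpace Y] [IsUniformAddGroup Y]
  [ContinuousSMul 𝕜 Y] [BarrelledSpace 𝕜 Y]

theorem isVonNBounded_compactTopology_iff (φ : X ≃L[𝕜] StrongDual 𝕜 Y)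
    {B : Set (WithTopology X (compactTopology φ))} :
    IsVonNBounded 𝕜 B ↔ ∃ p : Seminorm 𝕜 Y, Continuous p ∧
      WithTopology.toTopology _ ⁻¹' B ⊆ dualBall φ p :=
  isVonNBounded_withTopology_iff.trans (isBddFor_iff_exists_subset_dualBall φ
    (topology_le_compactTopology φ) (compactTopology_le_sigmaTopology φ))

variable [LocallyConvexSpace 𝕜 Y] [CompleteSpace Y]

omit [BarrelledSpace 𝕜 Y] in
theorem exists_eq_eval_of_mem_bddContDual (φ : X ≃L[𝕜] StrongDual 𝕜 Y)
    {f : Module.Dual 𝕜 X} (hf : f ∈ bddContDual 𝕜 τ (sigmaTopology φ)) :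
    ∃ y, ∀ x, f x = φ x y :=
  exists_eq_eval_of_continuousOn_dualBall (φ.toLinearEquiv : X →ₗ[𝕜] StrongDual 𝕜 Y)
    φ.surjective f fun _ hp => hf _ (isVonNBounded_dualBall φ hp)

/-- A functional that is continuous for `τ_{c,φ}(X, Y)`, as a functional on `X` whose restrictions
to bounded sets are weakly continuous. -/
def toBddContDual (φ : X ≃L[𝕜] StrongDual 𝕜 Y) :
    StrongDual 𝕜 (WithTopology X (compactTopology φ)) →ₗ[𝕜]
      bddContDual 𝕜 τ (sigmaTopology φ) where
  toFun f := ⟨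
    { toFun := fun x => f (WithTopology.toTopology _ x)
      map_add' := fun x z => map_add f (WithTopology.toTopology _ x) (WithTopology.toTopology _ z)
      map_smul' := fun c x => map_smul f c (WithTopology.toTopology _ x) },
    fun B hB => by
      refine continuousOn_of_induced_eq (coincideOnBdd_compactTopology φ B hB) ?_
      let := compactTopology φ
      exact (f.continuous.comp (WithTopology.continuous_toTopology _)).continuousOn⟩
  map_add' _ _ := rfl
  map_smul' _ _ := rfl

/-- Evaluation at a point of `Y`, as a functional on `X` with the topology `τ_{c,φ}(X, Y)`. -/
def evalCompactTopology (φ : X ≃L[𝕜] StrongDual 𝕜 Y) :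
    Y →ₗ[𝕜] StrongDual 𝕜 (WithTopology X (compactTopology φ)) where
  toFun y := (evalCompact 𝕜 Y y).comp (compactTopologyCLE φ).toContinuousLinearMap
  map_add' y z := by
    ext x
    exact map_add (φ (WithTopology.ofTopology x)) y z
  map_smul' c y := by
    ext x
    exact map_smul (φ (WithTopology.ofTopology x)) c y

theorem bijective_evalCompactTopology [T2Space Y] (φ : X ≃L[𝕜] StrongDual 𝕜 Y) :
    Function.Bijective (evalCompactTopology φ) := by
  constructor
  · intro y z h
    exact eq_of_forall_dual_eq φ.surjective fun x =>
      DFunLike.congr_fun h (WithTopology.toTopology _ x)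
  · intro f
    obtain ⟨y, hy⟩ := exists_eq_eval_of_mem_bddContDual φ (toBddContDual φ f).2
    exact ⟨y, ContinuousLinearMap.ext fun x => (hy (WithTopology.ofTopology x)).symm⟩

/-- The topological isomorphism between `Y` and the strong dual of `X` with `τ_{c,φ}(X, Y)`. -/
def evalCompactTopologyCLE [T2Space Y] (φ : X ≃L[𝕜] StrongDual 𝕜 Y) :
    Y ≃L[𝕜] StrongDual 𝕜 (WithTopology X (compactTopology φ)) where
  toLinearEquiv := LinearEquiv.ofBijective _ (bijective_evalCompactTopology φ)
  continuous_toFun := by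
    refine continuous_of_continuousAt_zero (evalCompactTopology φ) ?_
    rw [ContinuousAt, map_zero, (ContinuousLinearMap.hasBasis_nhds_zero_of_basis
      (Metric.nhds_basis_closedBall (x := (0 : 𝕜)))).tendsto_right_iff]
    rintro ⟨B, r⟩ ⟨hB, hr⟩
    obtain ⟨p, hp, hBp⟩ := (isVonNBounded_compactTopology_iff φ).1 hB
    have hpr : ∀ᶠ y in 𝓝 (0 : Y), p y < r :=
      (hp.tendsto 0).eventually_lt_const (by simpa using hr)
    filter_upwards [hpr] with y hy x hx
    exact mem_closedBall_zero_iff.2 ((hBp (a := WithTopology.ofTopology x) hx y).trans hy.le)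
  continuous_invFun := by
    let e := LinearEquiv.ofBijective _ (bijective_evalCompactTopology φ)
    refine continuous_of_continuousAt_zero e.symm fun V hV => ?_
    rw [map_zero] at hV
    obtain ⟨p, hp, hpV⟩ := exists_continuous_seminorm_le_one_subset (𝕜 := 𝕜) hV
    have hB : IsVonNBounded 𝕜 (WithTopology.ofTopology (t := compactTopology φ) ⁻¹' dualBall φ p) :=
      (isVonNBounded_compactTopology_iff φ).2 ⟨p, hp, subset_rfl⟩
    -- The polar of `p` is bounded and determines `p`, so a functional bounded by `1` on it comes
    -- from a point with `p ≤ 1`.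
    refine Filter.mem_map.2 <| Filter.mem_of_superset ((ContinuousLinearMap.hasBasis_nhds_zero_of_basis
      (Metric.nhds_basis_closedBall (x := (0 : 𝕜)))).mem_of_mem (i := (_, 1)) ⟨hB, one_pos⟩)
      fun f hf => hpV (seminorm_le_of_forall_dualBall φ.surjective hp fun x hx => ?_)
    have h1 := hf (WithTopology.toTopology _ x) hx
    rw [← e.apply_symm_apply f] at h1
    exact mem_closedBall_zero_iff.1 h1

theorem bijective_toBddContDual (φ : X ≃L[𝕜] StrongDual 𝕜 Y) :
    Function.Bijective (toBddContDual φ) := by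
  constructor
  · intro f g h
    ext x
    exact DFunLike.congr_fun (congrArg Subtype.val h) (WithTopology.ofTopology x)
  · intro f
    obtain ⟨y, hy⟩ := exists_eq_eval_of_mem_bddContDual φ f.2
    exact ⟨evalCompactTopology φ y, Subtype.ext (LinearMap.ext fun x => (hy x).symm)⟩

omit [LocallyConvexSpace 𝕜 Y] [CompleteSpace Y] in
-- Both sides carry uniform convergence on bounded sets, and the bounded sets are the same.
theorem isInducing_toBddContDual (φ : X ≃L[𝕜] StrongDual 𝕜 Y) :
    IsInducing (toBddContDual φ) := by
  have h : IsInducing fun f : bddContDual 𝕜 τ (sigmaTopology φ) =>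
      UniformOnFun.ofFun {B | IsBddFor 𝕜 τ B} (f : Module.Dual 𝕜 X) := ⟨rfl⟩
  rw [← h.of_comp_iff]
  have hbdd : ∀ B : Set (WithTopology X (compactTopology φ)),
      IsVonNBounded 𝕜 B ↔ IsBddFor 𝕜 τ (WithTopology.toTopology _ ⁻¹' B) := fun B =>
    isVonNBounded_withTopology_iff.trans (sameBdd_compactTopology φ _).symm
  let E : UniformOnFun (WithTopology X (compactTopology φ)) 𝕜 {B | IsVonNBounded 𝕜 B} ≃ᵤ
      UniformOnFun X 𝕜 {B | IsBddFor 𝕜 τ B} :=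
    UniformOnFun.congrLeft (WithTopology.equiv X (compactTopology φ)) (fun B hB => by
      have := (hbdd B).1 hB
      rwa [← WithTopology.image_ofTopology] at this) (fun B hB => by
      refine (hbdd _).2 ?_
      exact hB)
  exact E.isUniformEmbedding.isEmbedding.isInducing.comp
    (ContinuousLinearMap.isUniformEmbedding_toUniformOnFun
      (E := WithTopology X (compactTopology φ)) (F := 𝕜)
      (σ := RingHom.id 𝕜)).isEmbedding.isInducing

/-- The strong dual of `X` with `τ_{c,φ}(X, Y)` is the space of functionals whose restrictions to
bounded sets are weakly continuous. -/
def bddContDualCLE (φ : X ≃L[𝕜] StrongDual 𝕜 Y) :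
    StrongDual 𝕜 (WithTopology X (compactTopology φ)) ≃L[𝕜]
      bddContDual 𝕜 τ (sigmaTopology φ) where
  toLinearEquiv := LinearEquiv.ofBijective _ (bijective_toBddContDual φ)
  continuous_toFun := (isInducing_toBddContDual φ).continuous
  continuous_invFun := by
    let e := LinearEquiv.ofBijective _ (bijective_toBddContDual φ)
    rw [(isInducing_toBddContDual φ).continuous_iff]
    convert! continuous_id using 1
    ext1 f
    exact e.apply_symm_apply f

/-- The substance is `1 → 3`, which is Grothendieck's theorem; `2 → 1` holds because `σ_φ` is the
coarser topology. -/
theorem tfae_dual (φ : X ≃L[𝕜] StrongDual 𝕜 Y) [T2Space Y] (x' : X → 𝕜) : List.TFAE [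
      ∃ f : StrongDual 𝕜 (WithTopology X (compactTopology φ)),
        ∀ x, f (WithTopology.toTopology _ x) = x' x,
      ∃ f : StrongDual 𝕜 (WithTopology X (sigmaTopology φ)),
        ∀ x, f (WithTopology.toTopology _ x) = x' x,
      ∃ y : Y, ∀ x, x' x = φ x y,
      ∃! y : Y, ∀ x, x' x = φ x y] := by
  tfae_have 1 → 3 := by
    rintro ⟨f, hf⟩
    obtain ⟨y, hy⟩ := (bijective_evalCompactTopology φ).2 f
    exact ⟨y, fun x => by rw [← hf x, ← hy]; rfl⟩
  tfae_have 3 → 4 := by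
    rintro ⟨y, hy⟩
    exact ⟨y, hy, fun z hz => eq_of_forall_dual_eq φ.surjective fun x => (hz x).symm.trans (hy x)⟩
  tfae_have 4 → 2 := by
    rintro ⟨y, hy, -⟩
    refine ⟨
      { toFun := fun x => φ (WithTopology.ofTopology x) y
        map_add' := fun x z =>
          congrArg (· y) (map_add φ (WithTopology.ofTopology x) (WithTopology.ofTopology z))
        map_smul' := fun c x => congrArg (· y) (map_smul φ c (WithTopology.ofTopology x))
        cont := ?_ }, fun x => (hy x).symm⟩
    let := sigmaTopology φ
    exact (continuous_sigmaTopology_apply φ y).comp (WithTopology.continuous_ofTopology _)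
  tfae_have 2 → 1 := by
    rintro ⟨f, hf⟩
    refine ⟨
      { toFun := fun x => f (WithTopology.toTopology _ (WithTopology.ofTopology x))
        map_add' := fun x z => map_add f (WithTopology.toTopology _ (WithTopology.ofTopology x))
          (WithTopology.toTopology _ (WithTopology.ofTopology z))
        map_smul' := fun c x =>
          map_smul f c (WithTopology.toTopology _ (WithTopology.ofTopology x))
        cont := ?_ }, hf⟩
    have h1 : Continuous[sigmaTopology φ, _] fun x => f (WithTopology.toTopology _ x) := by
      let := sigmaTopology φ
      exact f.continuous.comp (WithTopology.continuous_toTopology _)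
    have h2 := continuous_le_dom (compactTopology_le_sigmaTopology φ) h1
    let := compactTopology φ
    exact h2.comp (WithTopology.continuous_ofTopology _)
  tfae_finish

end Duality

end LCDual

end

theorem mainTheorem11 {𝕜 X Y : Type*} [RCLike 𝕜]
    [AddCommGroup X] [Module 𝕜 X] [τ : TopologicalSpace X] [IsTopologicalAddGroup X]
    [ContinuousSMul 𝕜 X] [LocallyConvexSpace 𝕜 X] [T2Space X]
    [AddCommGroup Y] [Module 𝕜 Y] [UniformSpace Y] [IsUniformAddGroup Y]
    [ContinuousSMul 𝕜 Y] [LocallyConvexSpace 𝕜 Y] [T2Space Y]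
    [CompleteSpace Y] [BarrelledSpace 𝕜 Y]
    (φ : X ≃L[𝕜] StrongDual 𝕜 Y) :
    -- (a)
    (BBC 𝕜 τ (sigmaTopology φ) ∧ CNC 𝕜 τ (sigmaTopology φ) ∧
      mixedTopologyOf τ φ = compactTopology φ ∧
      SameBdd 𝕜 τ (mixedTopologyOf τ φ)) ∧
    -- (b)
    (∃ (κ : StrongDual 𝕜 (Y →L_c[𝕜] 𝕜) ≃L[𝕜]
          StrongDual 𝕜 (WithTopology X (mixedTopologyOf τ φ)))
        (κJ : Y ≃L[𝕜] StrongDual 𝕜 (WithTopology X (mixedTopologyOf τ φ)))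
        (I : X ≃L[𝕜] StrongDual 𝕜 (StrongDual 𝕜 (WithTopology X (mixedTopologyOf τ φ)))),
      (∀ y'' x, κ y'' (WithTopology.toTopology _ x) =
        y'' (UniformConvergenceCLM.ofFun (RingHom.id 𝕜) 𝕜 {N | IsCompact N} (φ x))) ∧
      (∀ y, κJ y = κ (evalCompact 𝕜 Y y)) ∧
      (∀ x x', I x x' = x' (WithTopology.toTopology _ x)) ∧
      ContinuousLinearMap.precomp 𝕜 κJ.toContinuousLinearMap =
        φ.toContinuousLinearMap.comp I.symm.toContinuousLinearMap) ∧
    (∃ e : StrongDual 𝕜 (WithTopology X (mixedTopologyOf τ φ)) ≃L[𝕜]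
        bddContDual 𝕜 τ (sigmaTopology φ),
      ∀ x' x, (e x' : Module.Dual 𝕜 X) x = x' (WithTopology.toTopology _ x)) ∧
    -- (c)
    (∀ x' : X → 𝕜, List.TFAE [
      ∃ f : StrongDual 𝕜 (WithTopology X (mixedTopologyOf τ φ)),
        ∀ x, f (WithTopology.toTopology _ x) = x' x,
      ∃ f : StrongDual 𝕜 (WithTopology X (sigmaTopology φ)),
        ∀ x, f (WithTopology.toTopology _ x) = x' x,
      ∃ y : Y, ∀ x, x' x = φ x y,
      ∃! y : Y, ∀ x, x' x = φ x y]) := by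
  rw [mixedTopologyOf_eq_compactTopology φ]
  refine ⟨⟨bbc_sigmaTopology φ, cnc_sigmaTopology φ, rfl, sameBdd_compactTopology φ⟩,
    ⟨(compactTopologyCLE φ).symm.arrowCongr (.refl 𝕜 𝕜), evalCompactTopologyCLE φ,
      φ.trans ((evalCompactTopologyCLE φ).arrowCongr (.refl 𝕜 𝕜)), fun _ _ => rfl, fun _ => rfl,
      fun x x' => ?_, ?_⟩,
    ⟨bddContDualCLE φ, fun _ _ => rfl⟩, tfae_dual φ⟩
  · exact DFunLike.congr_fun ((evalCompactTopologyCLE φ).apply_symm_apply x')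
      (WithTopology.toTopology _ x)
  · ext F y
    simp
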